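/- Let $m,n\ge 1$ be integers and let $\mathbb{R}^{m\times n}$ be the space of real $m\times n$ matrices, with the supremum metric. For $\mathbf{y}\in\mathbb{R}^m$ let $\langle\mathbf{y}\rangle$ be the unique point of $[-1/2,1/2)^m$ congruent to $\mathbf{y}$ modulo $\mathbb{Z}^m$, and let $\|\mathbf{y}\|=\max_j|\langle\mathbf{y}\rangle_j|$ be the distance from $\mathbf y$ to a nearest integer point. For $\mathbf{X}\in\mathbb{R}^{m\times n}$ and $\boldsymbol\theta\in\mathbb{R}^m$ let $\omega(\mathbf{X},\boldsymbol\theta)\in[0,\infty]$ be the supremum of all real $w\ge 0$ such that for arbitrarily large real $Q>1$ there is a nonzero $\mathbf{q}\in\mathbb{Z}^n$ with $$\|\mathbf{X}\mathbf{q}+\boldsymbol\theta\|<Q^{-w}\quad\text{and}\quad \max_i|q_i|\le Q,$$ and let $\omega^\times(\mathbf{X},\boldsymbol\theta)\in[0,\infty]$ be the supremum of all real $w\ge 0$ such that for arbitrarily large real $Q>1$ there is a nonzero $\mathbf{q}\in\mathbb{Z}^n$ with $$\prod_{j=1}^m|\langle\mathbf{X}\mathbf{q}+\boldsymbol\theta\rangle_j|<Q^{-mw}\quad\text{and}\quad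 \prod_{i=1}^n\max\{1,|q_i|\}\le Q^n.$$ Write $\omega(\mathbf{X})=\omega(\mathbf{X},\mathbf{0})$ and $\omega^\times(\mathbf{X})=\omega^\times(\mathbf{X},\mathbf{0})$. For $\mathbf{a}\in\mathbb{R}^n$ with Euclidean norm $1$, $\mathbf{b}\in\mathbb{R}^m$ and $\boldsymbol\varepsilon\in(0,\infty)^m$ put $$\mathcal{L}^{\boldsymbol\varepsilon}_{\mathbf{a},\mathbf{b}}=\{\mathbf{X}\in\mathbb{R}^{m\times n}: |\mathbf{X}_j\mathbf{a}+b_j|<\varepsilon_j\text{ for }1\le j\le m\},$$ where $\mathbf{X}_j$ is the $j$-th row of $\mathbf{X}$. Let $\nu$ be a Borel measure on $\mathbb{R}^{m\times n}$ with support $S$, and for a ball $B$ and $c>0$ let $cB$ be the ball with the same centre and $c$ times the radius. The measure $\nu$ is *strongly contracting* if it is finite, gives measure zero to every point, is doubling (there is $\lambda>1$ with $\nu(2B)\le\lambda\,\nu(B)$ for all balls $B$ centred in $S$), and there are constants $C,\alpha,r_0>0$ such that for all $\mathbf{a},\mathbf{b}$ as above, all $\boldsymbol\varepsilon\in(0,\infty)^m$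 with $\min_j\varepsilon_j<r_0$, all $\delta\in(0,1)$ and all $\mathbf{X}\in\mathcal{L}^{\delta\boldsymbol\varepsilon}_{\mathbf{a},\mathbf{b}}\cap S$ there is an open ball $B$ centred at $\mathbf{X}$ with $$B\cap S\subset\mathcal{L}^{\boldsymbol\varepsilon}_{\mathbf{a},\mathbf{b}}\quad\text{and}\quad \nu(5B\cap\mathcal{L}^{\delta\boldsymbol\varepsilon}_{\mathbf{a},\mathbf{b}})\le C\delta^\alpha\nu(5B).$$ It is *contracting* if the same holds with the last condition required only for $\boldsymbol\varepsilon$ with $\varepsilon_1=\dots=\varepsilon_m$. A Borel measure $\mu$ on $\mathbb{R}^{m\times n}$ is *(strongly) contracting almost everywhere* if $\mu$-almost every point $\mathbf{X}_0$ has a neighbourhood $U$ such that the restriction $\mu|_U$ is (strongly) contracting. **Theorem.** Let $\mu$ be a Borel measure on $\mathbb{R}^{m\times n}$ and let $v,v^\times\in[0,\infty]$. (A) If $\mu$ is contracting almost everywhere and $\omega(\mathbf{X})=v$ for $\mu$-almost every $\mathbf{X}$, then for every $\boldsymbol\theta\in\mathbb{R}^m$ we have $\omega(\mathbf{X},\boldsymbol\theta)\le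 v$ for $\mu$-almost every $\mathbf{X}$. (B) If $\mu$ is strongly contracting almost everywhere and $\omega^\times(\mathbf{X})=v^\times$ for $\mu$-almost every $\mathbf{X}$, then for every $\boldsymbol\theta\in\mathbb{R}^m$ we have $\omega^\times(\mathbf{X},\boldsymbol\theta)\le v^\times$ for $\mu$-almost every $\mathbf{X}$. -/

import Mathlib

open MeasureTheory Filter Topology
open scoped ENNReal NNReal

namespace DiophTransfer

noncomputable section

/-- The space of real `m × n` matrices, with the product topology, the Borel σ-algebra and the
supremum metric. -/
abbrev Mat (m n : ℕ) : Type := Fin m → Fin n → ℝ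

/-- The affine form `X q + θ`, a vector in `ℝ^m`. -/
def affineForm {m n : ℕ} (X : Mat m n) (θ : Fin m → ℝ) (q : Fin n → ℤ) : Fin m → ℝ :=
  fun j => ∑ i, X j i * (q i : ℝ) + θ j

/-- `⟨y⟩`: the unique point of `[-1/2, 1/2)^m` congruent to `y` modulo `ℤ^m`
(here `round x = ⌊x + 1/2⌋`). -/
def centered {m : ℕ} (y : Fin m → ℝ) : Fin m → ℝ :=
  fun j => y j - round (y j)

/-- The exponent `ω(X, θ) ∈ [0, ∞]`: the supremum of all `w ≥ 0` such that for arbitrarily large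
`Q` some nonzero `q ∈ ℤ^n` satisfies `‖X q + θ‖ < Q ^ (-w)` and `|q| ≤ Q`. Here
`‖centered y‖` is the distance (in the supremum norm) from `y` to a nearest integer point and
`‖q‖` is the supremum norm. -/
def omega {m n : ℕ} (X : Mat m n) (θ : Fin m → ℝ) : ℝ≥0∞ :=
  ⨆ (w : ℝ≥0) (_ : ∃ᶠ Q : ℝ in atTop, ∃ q : Fin n → ℤ, q ≠ 0 ∧
    ‖centered (affineForm X θ q)‖ < Q ^ (-(w : ℝ)) ∧ ‖q‖ ≤ Q), (w : ℝ≥0∞)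

/-- The multiplicative exponent `ω^×(X, θ) ∈ [0, ∞]`: the supremum of all `w ≥ 0` such that for
arbitrarily large `Q` some nonzero `q ∈ ℤ^n` satisfies
`∏ j, |⟨X q + θ⟩ j| < Q ^ (-m w)` and `∏ i, max 1 |q i| ≤ Q ^ n`. -/
def omegaMul {m n : ℕ} (X : Mat m n) (θ : Fin m → ℝ) : ℝ≥0∞ :=
  ⨆ (w : ℝ≥0) (_ : ∃ᶠ Q : ℝ in atTop, ∃ q : Fin n → ℤ, q ≠ 0 ∧
    ∏ j, |centered (affineForm X θ q) j| < Q ^ (-((m : ℝ) * (w : ℝ))) ∧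
    ∏ i, max 1 |(q i : ℝ)| ≤ Q ^ n), (w : ℝ≥0∞)

/-- The neighbourhood `{X : |X_j a + b_j| < ε_j for all j}` of the plane `{X : X a + b = 0}`. -/
def planeNhd {m n : ℕ} (a : Fin n → ℝ) (b : Fin m → ℝ) (ε : Fin m → ℝ) : Set (Mat m n) :=
  {X | ∀ j, |∑ i, X j i * a i + b j| < ε j}

/-- A measure is doubling if there is `c > 1` with `μ (2B) ≤ c μ (B)` for every ball `B` centred
in the support of `μ`. -/
def IsDoubling {m n : ℕ} (μ : Measure (Mat m n)) : Prop :=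
  ∃ c : ℝ≥0, 1 < c ∧ ∀ X ∈ μ.support, ∀ r : ℝ, 0 < r →
    μ (Metric.ball X (2 * r)) ≤ c * μ (Metric.ball X r)

/-- The contracting inequality with constants `C`, `α` for the single multi-radius `ε`: for every
plane and every `δ ∈ (0, 1)`, each point `X` of the support in the `δ ε`-neighbourhood of the plane
is the centre of an open ball `B` with `B ∩ supp μ` inside the `ε`-neighbourhood and
`μ (5B ∩ L^{δ ε}) ≤ C δ^α μ (5B)`. -/
def ContractsAt {m n : ℕ} (μ : Measure (Mat m n)) (C α : ℝ) (ε : Fin m → ℝ) : Prop :=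
  ∀ (a : Fin n → ℝ) (b : Fin m → ℝ), ∑ i, a i ^ 2 = 1 →
    ∀ δ : ℝ, 0 < δ → δ < 1 →
      ∀ X ∈ planeNhd a b (fun j => δ * ε j) ∩ μ.support, ∃ r : ℝ, 0 < r ∧
        Metric.ball X r ∩ μ.support ⊆ planeNhd a b ε ∧
        μ (Metric.ball X (5 * r) ∩ planeNhd a b (fun j => δ * ε j)) ≤
          ENNReal.ofReal (C * δ ^ α) * μ (Metric.ball X (5 * r))

/-- Strongly contracting measures: non-atomic, finite, doubling, with the contracting inequality
for all `ε ∈ (0, ∞)^m` whose smallest entry is less than `r₀`. -/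
structure IsStronglyContracting {m n : ℕ} (μ : Measure (Mat m n)) : Prop where
  nonatomic : ∀ X, μ {X} = 0
  finite : μ Set.univ < ∞
  doubling : IsDoubling μ
  contracts : ∃ C α r₀ : ℝ, 0 < C ∧ 0 < α ∧ 0 < r₀ ∧
    ∀ ε : Fin m → ℝ, (∀ j, 0 < ε j) → (∃ j, ε j < r₀) → ContractsAt μ C α ε

/-- Contracting measures: the same with `ε_1 = ⋯ = ε_m`. -/
structure IsContracting {m n : ℕ} (μ : Measure (Mat m n)) : Prop where
  nonatomic : ∀ X, μ {X} = 0
  finite : μ Set.univ < ∞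
  doubling : IsDoubling μ
  contracts : ∃ C α r₀ : ℝ, 0 < C ∧ 0 < α ∧ 0 < r₀ ∧
    ∀ ε : ℝ, 0 < ε → ε < r₀ → ContractsAt μ C α (fun _ => ε)

/-- `μ` is contracting almost everywhere. -/
def ContractingAE {m n : ℕ} (μ : Measure (Mat m n)) : Prop :=
  ∀ᵐ X₀ ∂μ, ∃ U ∈ 𝓝 X₀, IsContracting (μ.restrict U)

/-- `μ` is strongly contracting almost everywhere. -/
def StronglyContractingAE {m n : ℕ} (μ : Measure (Mat m n)) : Prop :=
  ∀ᵐ X₀ ∂μ, ∃ U ∈ 𝓝 X₀, IsStronglyContracting (μ.restrict U)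

end

end DiophTransfer

/-! Fix `θ` and work at dyadic heights `2 ^ t`. A pair `(q, p)` approximates well at `X` when `X q +
θ - p` lies in a small box, that is, when `X` lies near a plane. If `X` is near two such planes with
different `q`, `q'`, subtraction removes `θ` and makes `q - q'` almost as good a homogeneous
solution. The homogeneous exponent forbids this for almost every `X` and all large `t`, so the plane
neighbourhoods of level `t` are eventually disjoint at almost every point. Shrink the boxes by `2 ^
(-γ t)`. By contraction, a Vitali cover of the smaller neighbourhood has mass at most a factor of
order `2 ^ (-γ α t)` times that of disjoint balls inside the larger one. Disjointness bounds the sum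
over all planes by the finite total mass, and Borel–Cantelli finishes:
`ae_eventually_notMem_of_contracting`. As disjointness holds only on a set `G` depending on the
starting level, balls must be compared with their part in `G`; Lebesgue density does this in
`ae_exists_measure_ball_le`. In (B), the small-product region is covered, with a loss of order `η`
in the exponent, by finitely many shapes of boxes. Their sides are unequal, whence strong
contraction. A side of order 1 does not determine `p j`; that coordinate is freed by a huge side and
`p j = 0`, which is allowed because only the smallest side has to be small. -/

namespace DiophTransfer

/-! ### Coverings, density and the Borel–Cantelli argument -/

section Core

/-- A Vitali covering of a bounded set by balls of possibly unbounded radii. -/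
theorem exists_disjoint_balls_covering {X : Type*} [MetricSpace X] {A : Set X}
    (hA : Bornology.IsBounded A) (r : X → ℝ) (hr : ∀ x ∈ A, 0 < r x) :
    ∃ u ⊆ A, u.PairwiseDisjoint (fun x => Metric.ball x (r x)) ∧
      A ⊆ ⋃ x ∈ u, Metric.ball x (5 * r x) := by
  obtain ⟨R, hR⟩ := Metric.isBounded_iff.1 hA
  -- A radius exceeding the diameter bound `R` gives a single ball covering `A`; otherwise the radii
  -- are bounded and Vitali applies.
  by_cases hbig : ∃ x ∈ A, R < r x
  · obtain ⟨x, hx, hxR⟩ := hbig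
    refine ⟨{x}, by simpa using hx, Set.pairwiseDisjoint_singleton _ _, fun y hy => ?_⟩
    have := hR hy hx
    have := hr x hx
    simp only [Set.mem_singleton_iff, Set.iUnion_iUnion_eq_left, Metric.mem_ball]
    linarith
  · push Not at hbig
    obtain ⟨u, huA, hdisj, hcov⟩ := Vitali.exists_disjoint_subfamily_covering_enlargement
      (fun x => Metric.ball x (r x)) A r 2 (by norm_num) (fun x hx => (hr x hx).le) R hbig
      (fun x hx => ⟨x, Metric.mem_ball_self (hr x hx)⟩)
    refine ⟨u, huA, hdisj, fun x hx => ?_⟩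
    obtain ⟨y, hy, ⟨z, hzx, hzy⟩, hle⟩ := hcov x hx
    refine Set.mem_biUnion hy ?_
    have h1 : dist z x < r x := hzx
    have h2 : dist z y < r y := hzy
    have h3 := dist_triangle_left x y z
    have := hr y (huA hy)
    rw [Metric.mem_ball]
    linarith

theorem measure_ball_five_mul_le {X : Type*} [MetricSpace X] [MeasurableSpace X] {ν : Measure X} {c : ℝ≥0}
    (hd : ∀ x ∈ ν.support, ∀ r : ℝ, 0 < r →
      ν (Metric.ball x (2 * r)) ≤ c * ν (Metric.ball x r))
    {x : X} (hx : x ∈ ν.support) {r : ℝ} (hr : 0 < r) :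
    ν (Metric.ball x (5 * r)) ≤ (c : ℝ≥0∞) ^ 3 * ν (Metric.ball x r) := by
  calc ν (Metric.ball x (5 * r)) ≤ ν (Metric.ball x (2 * (2 * (2 * r)))) :=
        measure_mono (Metric.ball_subset_ball (by linarith))
    _ ≤ c * (c * (c * ν (Metric.ball x r))) := by
        refine (hd x hx _ (by positivity)).trans ?_
        gcongr
        refine (hd x hx _ (by positivity)).trans ?_
        gcongr
        exact hd x hx _ hr
    _ = _ := by ring

variable {X : Type*} [MetricSpace X] [SecondCountableTopology X] [MeasurableSpace X]
  [BorelSpace X]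

/-- Summing the contracting inequality over a disjoint family of balls. -/
theorem measure_le_of_contracting {ν : Measure X} {c : ℝ≥0}
    (hd : ∀ x ∈ ν.support, ∀ r : ℝ, 0 < r →
      ν (Metric.ball x (2 * r)) ≤ c * ν (Metric.ball x r))
    {A E F G : Set X} (hA : Bornology.IsBounded A) (hAE : A ⊆ E) (hAS : A ⊆ ν.support)
    (hG : MeasurableSet G) {κ k : ℝ≥0∞}
    (hk : ∀ x ∈ A, ∀ r : ℝ, 0 < r → ν (Metric.ball x r) ≤ k * ν (Metric.ball x r ∩ G))
    (h : ∀ x ∈ A, ∃ r : ℝ, 0 < r ∧ Metric.ball x r ∩ ν.support ⊆ F ∧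
      ν (Metric.ball x (5 * r) ∩ E) ≤ κ * ν (Metric.ball x (5 * r))) :
    ν A ≤ κ * ((c : ℝ≥0∞) ^ 3 * k) * ν (F ∩ G) := by
  choose! r hr hF hE using h
  obtain ⟨u, huA, hdisj, hcov⟩ := exists_disjoint_balls_covering hA r hr
  have hu : u.Countable := hdisj.countable_of_isOpen (fun _ _ => Metric.isOpen_ball)
    (fun x hx => ⟨x, Metric.mem_ball_self (hr x (huA hx))⟩)
  have hsum : ∑' x : u, ν (Metric.ball (x : X) (r x) ∩ G) ≤ ν (F ∩ G) := by
    rw [← measure_biUnion hu (hdisj.mono fun x => Set.inter_subset_left)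
      (fun x _ => Metric.isOpen_ball.measurableSet.inter hG)]
    -- The balls lie in `F` only within the support, which carries full measure.
    apply measure_mono_ae
    filter_upwards [Measure.support_mem_ae (μ := ν)] with y hy hyu
    obtain ⟨x, hx, hyx, hyG⟩ := Set.mem_iUnion₂.1 hyu
    exact ⟨hF x (huA hx) ⟨hyx, hy⟩, hyG⟩
  calc ν A ≤ ν (⋃ x ∈ u, Metric.ball x (5 * r x) ∩ E) := by
        refine measure_mono fun y hy => ?_
        obtain ⟨x, hx, hyx⟩ := Set.mem_iUnion₂.1 (hcov hy)
        exact Set.mem_biUnion hx ⟨hyx, hAE hy⟩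
    _ ≤ ∑' x : u, ν (Metric.ball (x : X) (5 * r x) ∩ E) := measure_biUnion_le ν hu _
    _ ≤ ∑' x : u, κ * ((c : ℝ≥0∞) ^ 3 * k) * ν (Metric.ball (x : X) (r x) ∩ G) := by
        refine ENNReal.tsum_le_tsum fun x => (hE x (huA x.2)).trans ?_
        rw [mul_assoc, mul_assoc]
        gcongr
        refine (measure_ball_five_mul_le hd (hAS (huA x.2)) (hr _ (huA x.2))).trans ?_
        gcongr
        exact hk x (huA x.2) _ (hr _ (huA x.2))
    _ = κ * ((c : ℝ≥0∞) ^ 3 * k) * ∑' x : u, ν (Metric.ball (x : X) (r x) ∩ G) :=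
        ENNReal.tsum_mul_left
    _ ≤ _ := by gcongr

/-- Almost every point of a measurable set `G` sees `G` in a fixed proportion at all scales. -/
theorem ae_exists_measure_ball_le [HasBesicovitchCovering X] {ν : Measure X} [IsFiniteMeasure ν]
    {c : ℝ≥0} (hd : ∀ x ∈ ν.support, ∀ r : ℝ, 0 < r →
      ν (Metric.ball x (2 * r)) ≤ c * ν (Metric.ball x r))
    {G : Set X} (hG : MeasurableSet G) :
    ∀ᵐ x ∂ν, x ∈ G → ∃ k : ℕ, ∀ r : ℝ, 0 < r →
      ν (Metric.ball x r) ≤ k * ν (Metric.ball x r ∩ G) := by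
  have h := Besicovitch.ae_tendsto_measure_inter_div ν G
  rw [ae_restrict_iff' hG] at h
  filter_upwards [h, Measure.support_mem_ae (μ := ν)] with x hx hxS hxG
  have h2 := (hx hxG).eventually (lt_mem_nhds (show (1 / 2 : ℝ≥0∞) < 1 by
    rw [one_div]; exact ENNReal.inv_lt_one.2 (by norm_num)))
  obtain ⟨ρ, hρ, hsmall⟩ := mem_nhdsGT_iff_exists_Ioo_subset.1 h2
  have hρ0 : (0 : ℝ) < ρ := hρ
  have hpos : ∀ r : ℝ, 0 < r → 0 < ν (Metric.ball x r) := fun r hr =>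
    (Measure.mem_support_iff_forall x).1 hxS _ (Metric.ball_mem_nhds x hr)
  -- Differentiation concerns closed balls; one doubling passes from the open ball of radius `r` to
  -- the closed ball of radius `r / 2`.
  have hloc : ∀ r : ℝ, 0 < r → r < ρ →
      ν (Metric.ball x r) ≤ (2 * c : ℝ≥0) * ν (Metric.ball x r ∩ G) := by
    intro r hr hrρ
    have h3 : (1 / 2 : ℝ≥0∞) < ν (G ∩ Metric.closedBall x (r / 2)) /
        ν (Metric.closedBall x (r / 2)) := hsmall ⟨by positivity, by linarith⟩
    have h4 : ν (Metric.closedBall x (r / 2)) ≤ 2 * ν (G ∩ Metric.closedBall x (r / 2)) := by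
      have h5 := ENNReal.mul_le_of_le_div h3.le
      rw [one_div, mul_comm, ← div_eq_mul_inv] at h5
      have := ENNReal.div_le_iff_le_mul (b := (2 : ℝ≥0∞)) (by simp) (by simp) |>.1 h5
      rwa [mul_comm]
    calc ν (Metric.ball x r) = ν (Metric.ball x (2 * (r / 2))) := by congr 2; ring
      _ ≤ c * ν (Metric.ball x (r / 2)) := hd x hxS _ (by positivity)
      _ ≤ c * ν (Metric.closedBall x (r / 2)) := by
          gcongr; exact Metric.ball_subset_closedBall
      _ ≤ c * (2 * ν (G ∩ Metric.closedBall x (r / 2))) := by gcongr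
      _ ≤ c * (2 * ν (Metric.ball x r ∩ G)) := by
          rw [Set.inter_comm]
          gcongr
          exact Metric.closedBall_subset_ball (by linarith)
      _ = _ := by push_cast; ring
  have hρ2 : 0 < ν (Metric.ball x (ρ / 2) ∩ G) := by
    have := (hpos (ρ / 2) (by positivity)).trans_le (hloc _ (by positivity) (by linarith))
    exact pos_iff_ne_zero.2 fun h0 => by simp [h0] at this
  -- Radii at least `ρ`: the total mass is finite and `G` already has positive mass near `x`.
  obtain ⟨k₁, hk₁⟩ := ENNReal.exists_nat_mul_gt hρ2.ne' (measure_ne_top ν Set.univ)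
  obtain ⟨k₂, hk₂⟩ := exists_nat_ge (2 * c)
  refine ⟨max k₁ k₂, fun r hr => ?_⟩
  rcases lt_or_ge r ρ with hrρ | hrρ
  · refine (hloc r hr hrρ).trans ?_
    gcongr
    calc ((2 * c : ℝ≥0) : ℝ≥0∞) ≤ ((k₂ : ℝ≥0) : ℝ≥0∞) := by exact_mod_cast hk₂
      _ ≤ _ := by simp
  · calc ν (Metric.ball x r) ≤ ν Set.univ := measure_mono (Set.subset_univ _)
      _ ≤ k₁ * ν (Metric.ball x (ρ / 2) ∩ G) := hk₁.le
      _ ≤ _ := by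
        gcongr
        · simp
        · linarith

/-- The transference principle: if the outer sets `F t i` of a contracting family are eventually
disjoint at almost every point, then almost every point lies in the inner sets `E t i` for only
finitely many `t`. -/
theorem ae_eventually_notMem_of_contracting [HasBesicovitchCovering X] {ν : Measure X}
    [IsFiniteMeasure ν] {c : ℝ≥0} (hd : ∀ x ∈ ν.support, ∀ r : ℝ, 0 < r →
      ν (Metric.ball x (2 * r)) ≤ c * ν (Metric.ball x r))
    {ι : Type*} [Countable ι] {E F : ℕ → ι → Set X} (hF : ∀ t i, MeasurableSet (F t i))
    {κ : ℕ → ℝ≥0∞} (hκ : ∑' t, κ t ≠ ∞)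
    (hcontr : ∀ᶠ t in atTop, ∀ i, ∀ x ∈ E t i ∩ ν.support, ∃ r : ℝ, 0 < r ∧
      Metric.ball x r ∩ ν.support ⊆ F t i ∧
      ν (Metric.ball x (5 * r) ∩ E t i) ≤ κ t * ν (Metric.ball x (5 * r)))
    (hinter : ∀ᵐ x ∂ν, ∀ᶠ t in atTop, ∀ i j, x ∈ F t i → x ∈ F t j → i = j) :
    ∀ᵐ x ∂ν, ∀ᶠ t in atTop, ∀ i, x ∉ E t i := by
  rcases isEmpty_or_nonempty X with hX | ⟨⟨x₀⟩⟩
  · exact Eventually.of_forall fun x => hX.elim x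
  set G : ℕ → Set X := fun N => {x | ∀ t ≥ N, ∀ i j, x ∈ F t i → x ∈ F t j → i = j} with hGdef
  have hGm : ∀ N, MeasurableSet (G N) := by
    intro N
    have : G N = ⋂ (t : ℕ) (_ : t ≥ N) (i : ι) (j : ι) (_ : i ≠ j), (F t i ∩ F t j)ᶜ := by
      ext x
      simp only [hGdef, Set.mem_ofPred_eq, Set.mem_iInter, Set.mem_compl_iff, Set.mem_inter_iff]
      refine forall₄_congr fun t _ i j => ?_
      tauto
    rw [this]
    exact .iInter fun t => .iInter fun _ => .iInter fun i => .iInter fun j => .iInter fun _ =>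
      ((hF t i).inter (hF t j)).compl
  -- Countably many bounded pieces exhaust almost all of the space; on each, the starting level and
  -- the density constant are uniform.
  set D : ℕ → ℕ → Set X := fun N k => {x | x ∈ G N ∧ x ∈ ν.support ∧ dist x x₀ ≤ k ∧
    ∀ r : ℝ, 0 < r → ν (Metric.ball x r) ≤ k * ν (Metric.ball x r ∩ G N)} with hDdef
  have hDae : ∀ᵐ x ∂ν, ∃ N k, x ∈ D N k := by
    have h1 := ae_all_iff.2 fun N => ae_exists_measure_ball_le hd (hGm N)
    filter_upwards [h1, hinter, Measure.support_mem_ae (μ := ν)] with x hx hxi hxS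
    obtain ⟨N, hN⟩ := eventually_atTop.1 hxi
    obtain ⟨k, hk⟩ := hx N hN
    obtain ⟨k', hk'⟩ := exists_nat_ge (dist x x₀)
    refine ⟨N, max k k', hN, hxS, hk'.trans (by simp), fun r hr => (hk r hr).trans ?_⟩
    gcongr
    simp
  have hmain : ∀ N k, ∀ᵐ x ∂ν, ∀ᶠ t in atTop, x ∉ D N k ∩ ⋃ i, E t i := by
    intro N k
    obtain ⟨T, hT⟩ := eventually_atTop.1 hcontr
    set M := max T N
    have hb : ∀ t, ν (D N k ∩ ⋃ i, E (t + M) i) ≤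
        κ (t + M) * ((c : ℝ≥0∞) ^ 3 * k * ν Set.univ) := by
      intro t
      calc ν (D N k ∩ ⋃ i, E (t + M) i) = ν (⋃ i, D N k ∩ E (t + M) i) := by
            rw [Set.inter_iUnion]
        _ ≤ ∑' i, ν (D N k ∩ E (t + M) i) := measure_iUnion_le _
        _ ≤ ∑' i, κ (t + M) * ((c : ℝ≥0∞) ^ 3 * k) * ν (F (t + M) i ∩ G N) := by
            refine ENNReal.tsum_le_tsum fun i => ?_
            refine measure_le_of_contracting (E := E (t + M) i) hd ?_ Set.inter_subset_right
              (fun x hx => hx.1.2.1) (hGm N) (fun x hx => hx.1.2.2.2) ?_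
            · exact (Metric.isBounded_closedBall (x := x₀) (r := k)).subset fun x hx => hx.1.2.2.1
            · exact fun x hx => hT (t + M) (le_trans (le_max_left _ _) (Nat.le_add_left _ _)) i x
                ⟨hx.2, hx.1.2.1⟩
        _ = κ (t + M) * ((c : ℝ≥0∞) ^ 3 * k) * ∑' i, ν (F (t + M) i ∩ G N) :=
            ENNReal.tsum_mul_left
        _ = κ (t + M) * ((c : ℝ≥0∞) ^ 3 * k) * ν (⋃ i, F (t + M) i ∩ G N) := by
            rw [measure_iUnion _ fun i => (hF _ i).inter (hGm N)]
            intro i j hij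
            refine Set.disjoint_left.2 fun x hxi hxj => hij ?_
            exact hxi.2 (t + M) (le_trans (le_max_right _ _) (Nat.le_add_left _ _)) i j hxi.1 hxj.1
        _ ≤ κ (t + M) * ((c : ℝ≥0∞) ^ 3 * k) * ν Set.univ := by
            gcongr; exact Set.subset_univ _
        _ = _ := by ring
    have hfin : ∑' t, ν (D N k ∩ ⋃ i, E (t + M) i) ≠ ∞ := by
      refine ne_top_of_le_ne_top ?_ (ENNReal.tsum_le_tsum hb)
      rw [ENNReal.tsum_mul_right]
      refine ENNReal.mul_ne_top (ne_top_of_le_ne_top hκ ?_) ?_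
      · exact ENNReal.tsum_comp_le_tsum_of_injective (add_left_injective M) κ
      · exact ENNReal.mul_ne_top (ENNReal.mul_ne_top (by simp) (by simp)) (measure_ne_top _ _)
    filter_upwards [ae_eventually_notMem hfin] with x hx
    obtain ⟨T', hT'⟩ := eventually_atTop.1 hx
    refine eventually_atTop.2 ⟨T' + M, fun t ht => ?_⟩
    have := hT' (t - M) (by omega)
    rwa [Nat.sub_add_cancel (by omega)] at this
  filter_upwards [hDae, ae_all_iff.2 fun N => ae_all_iff.2 (hmain N)] with x ⟨N, k, hx⟩ hx'
  filter_upwards [hx' N k] with t ht i hi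
  exact ht ⟨hx, Set.mem_iUnion.2 ⟨i, hi⟩⟩

end Core

/-! ### Neighbourhoods of rational planes -/

section Planes

variable {m n : ℕ}

theorem planeNhd_div (q : Fin n → ℤ) (θ : Fin m → ℝ) (p : Fin m → ℤ) (ε : Fin m → ℝ) {s : ℝ}
    (hs : 0 < s) :
    planeNhd (fun i => (q i : ℝ) / s) (fun j => (θ j - p j) / s) (fun j => ε j / s) =
      {X : Mat m n | ∀ j, |affineForm X θ q j - p j| < ε j} := by
  ext X
  refine forall_congr' fun j => ?_
  have : ∑ i, X j i * ((q i : ℝ) / s) + (θ j - p j) / s = (affineForm X θ q j - p j) / s := by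
    simp only [affineForm, ← mul_div_assoc, ← Finset.sum_div]
    ring
  rw [this, abs_div, abs_of_pos hs, div_lt_div_iff_of_pos_right hs]

theorem measurableSet_affineForm_lt (q : Fin n → ℤ) (θ : Fin m → ℝ) (p : Fin m → ℤ)
    (ε : Fin m → ℝ) :
    MeasurableSet {X : Mat m n | ∀ j, |affineForm X θ q j - p j| < ε j} := by
  have : {X : Mat m n | ∀ j, |affineForm X θ q j - p j| < ε j} =
      ⋂ j, {X : Mat m n | |affineForm X θ q j - p j| < ε j} := by
    ext; simp
  rw [this]
  refine .iInter fun j => (isOpen_lt ?_ continuous_const).measurableSet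
  unfold affineForm
  fun_prop

theorem affineForm_sub (X : Mat m n) (θ : Fin m → ℝ) (q q' : Fin n → ℤ) (j : Fin m) :
    affineForm X 0 (q - q') j = affineForm X θ q j - affineForm X θ q' j := by
  simp [affineForm, mul_sub, Finset.sum_sub_distrib]

theorem one_le_sqrt_sum_sq {q : Fin n → ℤ} (hq : q ≠ 0) : 1 ≤ √(∑ i, (q i : ℝ) ^ 2) := by
  obtain ⟨i, hi⟩ := Function.ne_iff.1 hq
  rw [Real.one_le_sqrt]
  have h1 : (1 : ℝ) ≤ (q i : ℝ) ^ 2 := by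
    have hi' : q i ≠ 0 := hi
    have : 0 < q i ^ 2 := by positivity
    exact_mod_cast this
  exact h1.trans (Finset.single_le_sum (f := fun i => (q i : ℝ) ^ 2)
    (fun i _ => sq_nonneg _) (Finset.mem_univ i))

theorem tendsto_two_rpow_neg_mul {e : ℝ} (he : 0 < e) :
    Tendsto (fun t : ℕ => (2 : ℝ) ^ (-(e * t))) atTop (𝓝 0) := by
  have h1 : Tendsto (fun t : ℕ => e * (t : ℝ)) atTop atTop :=
    tendsto_natCast_atTop_atTop.const_mul_atTop he
  exact (tendsto_rpow_atBot_of_base_gt_one (b := (2 : ℝ)) (by norm_num)).comp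
    (tendsto_neg_atTop_atBot.comp h1)

/-- The transference principle for systems of affine forms. The coordinates `j` with `e j ≤ 0` are
unconstrained in the homogeneous problem. -/
theorem ae_eventually_le_abs_affineForm {ν : Measure (Mat m n)} (hfin : ν Set.univ < ∞)
    (hd : IsDoubling ν) {C α : ℝ} (hα : 0 < α) (e : Fin m → ℝ) {γ : ℝ} (hγ : 0 < γ)
    (hcon : ∀ᶠ t : ℕ in atTop, ∀ s : ℝ, 1 ≤ s →
      ContractsAt ν C α (fun j => (2 : ℝ) ^ (-(e j * t)) / s))
    (Qs : ℕ → Set (Fin n → ℤ)) (θ : Fin m → ℝ)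
    (hhom : ∀ᵐ X ∂ν, ∀ᶠ t : ℕ in atTop, ∀ q ∈ Qs t, ∀ q' ∈ Qs t, q ≠ q' →
      ∃ j, 0 < e j ∧ 2 * (2 : ℝ) ^ (-(e j * t)) ≤ |centered (affineForm X 0 (q - q')) j|) :
    ∀ᵐ X ∂ν, ∀ᶠ t : ℕ in atTop, ∀ q ∈ Qs t, q ≠ 0 → ∀ p : Fin m → ℤ,
      (∀ j, e j ≤ 0 → p j = 0) →
        ∃ j, (2 : ℝ) ^ (-((e j + γ) * t)) ≤ |affineForm X θ q j - p j| := by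
  obtain ⟨c, -, hd⟩ := hd
  have : IsFiniteMeasure ν := ⟨hfin⟩
  -- Inadmissible indices give empty sets, so one index type serves every `t`.
  set Adm : ℕ → (Fin n → ℤ) × (Fin m → ℤ) → Prop := fun t i =>
    i.1 ∈ Qs t ∧ i.1 ≠ 0 ∧ ∀ j, e j ≤ 0 → i.2 j = 0 with hAdm
  set P : (ℕ → Fin m → ℝ) → ℕ → (Fin n → ℤ) × (Fin m → ℤ) → Set (Mat m n) := fun ε t i =>
    {X | Adm t i ∧ ∀ j, |affineForm X θ i.1 j - i.2 j| < ε t j} with hP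
  have key := ae_eventually_notMem_of_contracting hd
    (E := P fun t j => (2 : ℝ) ^ (-((e j + γ) * t))) (F := P fun t j => (2 : ℝ) ^ (-(e j * t)))
    (κ := fun t => ENNReal.ofReal (C * ((2 : ℝ) ^ (-(γ * t))) ^ α)) ?_ ?_ ?_ ?_
  · filter_upwards [key] with X hX
    filter_upwards [hX] with t ht q hq hq0 p hp
    by_contra! hcon
    exact ht (q, p) ⟨⟨hq, hq0, hp⟩, hcon⟩
  · exact fun t i => (MeasurableSet.const _).inter (measurableSet_affineForm_lt _ _ _ _)
  · have h1 : (fun t : ℕ => C * ((2 : ℝ) ^ (-(γ * t))) ^ α) =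
        fun t : ℕ => C * ((2 : ℝ) ^ (-(γ * α))) ^ t := by
      ext t
      rw [← Real.rpow_mul (by norm_num), ← Real.rpow_natCast, ← Real.rpow_mul (by norm_num)]
      ring_nf
    have h2 : Summable fun t : ℕ => C * ((2 : ℝ) ^ (-(γ * t))) ^ α := by
      rw [h1]
      refine (summable_geometric_of_lt_one (by positivity) ?_).mul_left C
      exact Real.rpow_lt_one_of_one_lt_of_neg (by norm_num) (by simpa using mul_pos hγ hα)
    exact h2.tsum_ofReal_ne_top
  · filter_upwards [hcon, eventually_ge_atTop 1] with t ht ht1 ⟨q, p⟩ X ⟨⟨hadm, hX⟩, hXS⟩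
    have hs := one_le_sqrt_sum_sq hadm.2.1
    -- Dividing by the Euclidean norm of `q` gives the unit normal required; as `s ≥ 1`, the radii
    -- only shrink.
    set s := √(∑ i, (q i : ℝ) ^ 2) with hsdef
    have hs0 : 0 < s := by linarith
    have hnorm : ∑ i, ((q i : ℝ) / s) ^ 2 = 1 := by
      simp only [div_pow, ← Finset.sum_div]
      rw [hsdef, Real.sq_sqrt (by positivity), div_self]
      intro h0
      rw [hsdef, h0] at hs0
      simp at hs0
    have hδ1 : (2 : ℝ) ^ (-(γ * t)) < 1 := by
      refine Real.rpow_lt_one_of_one_lt_of_neg (by norm_num) ?_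
      have : (1 : ℝ) ≤ t := by exact_mod_cast ht1
      have : 0 < γ * t := by positivity
      linarith
    have hin : planeNhd (fun i => (q i : ℝ) / s) (fun j => (θ j - p j) / s)
        (fun j => (2 : ℝ) ^ (-(γ * t)) * ((2 : ℝ) ^ (-(e j * t)) / s)) =
        {X : Mat m n | ∀ j, |affineForm X θ q j - p j| < (2 : ℝ) ^ (-((e j + γ) * t))} := by
      rw [← planeNhd_div q θ p _ hs0]
      congr 1
      ext j
      rw [← mul_div_assoc, ← Real.rpow_add (by norm_num)]
      ring_nf
    obtain ⟨r, hr, hsub, hle⟩ := ht s hs (fun i => (q i : ℝ) / s) (fun j => (θ j - p j) / s) hnorm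
      ((2 : ℝ) ^ (-(γ * t))) (by positivity) hδ1 X ⟨by rw [hin]; exact hX, hXS⟩
    rw [planeNhd_div q θ p _ hs0] at hsub
    rw [hin] at hle
    refine ⟨r, hr, fun Y hY => ⟨hadm, hsub hY⟩, le_trans (measure_mono ?_) hle⟩
    exact Set.inter_subset_inter_right _ fun Y hY => hY.2
  · have hsmall : ∀ᶠ t : ℕ in atTop, ∀ j, 0 < e j → (2 : ℝ) ^ (-(e j * t)) < 1 / 2 := by
      refine eventually_all.2 fun j => ?_
      by_cases hj : 0 < e j
      · filter_upwards [(tendsto_two_rpow_neg_mul hj).eventually_lt_const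
          (show (0 : ℝ) < 1 / 2 by norm_num)] with t ht _ using ht
      · exact Eventually.of_forall fun t h => absurd h hj
    filter_upwards [hhom] with X hX
    filter_upwards [hX, hsmall] with t ht hts ⟨q, p⟩ ⟨q', p'⟩ ⟨hadm, hF⟩ ⟨hadm', hF'⟩
    have hdiff : ∀ j, |(affineForm X θ q j - affineForm X θ q' j) - ((p j - p' j : ℤ) : ℝ)| <
        2 * (2 : ℝ) ^ (-(e j * t)) := by
      intro j
      have h1 := hF j
      have h2 := hF' j
      have h3 := abs_sub (affineForm X θ q j - p j) (affineForm X θ q' j - p' j)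
      push_cast
      calc _ = |(affineForm X θ q j - p j) - (affineForm X θ q' j - p' j)| := by congr 1; ring
        _ < _ := by dsimp only at h1 h2; linarith
    have hqq : q = q' := by
      by_contra hne
      obtain ⟨j, hj, hle⟩ := ht q hadm.1 q' hadm'.1 hne
      have h1 := hdiff j
      rw [← affineForm_sub] at h1
      have h2 := round_le (affineForm X 0 (q - q') j) (p j - p' j)
      simp only [centered] at hle
      linarith
    subst hqq
    refine Prod.ext rfl (funext fun j => ?_)
    rcases le_or_gt (e j) 0 with hj | hj
    · exact (hadm.2.2 j hj).trans (hadm'.2.2 j hj).symm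
    · have h1 := hdiff j
      have h2 := hts j hj
      rw [sub_self, zero_sub, abs_neg] at h1
      have h3 : |((p j - p' j : ℤ) : ℝ)| < 1 := by linarith
      rw [← Int.cast_abs] at h3
      have h4 : |p j - p' j| < 1 := by exact_mod_cast h3
      exact sub_eq_zero.1 (Int.abs_lt_one_iff.1 h4)

end Planes

/-! ### Localisation and reduction to dyadic heights -/

section Reductions

variable {m n : ℕ}

/-- Lindelöf: in a second countable space, a locally null set is null. The neighbourhoods `U` need
not be measurable. -/
theorem ae_of_ae_restrict_nhds {X : Type*} [TopologicalSpace X] [SecondCountableTopology X]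
    [MeasurableSpace X] {μ : Measure X} {p : X → Prop}
    (h : ∀ᵐ x₀ ∂μ, ∃ U ∈ 𝓝 x₀, ∀ᵐ x ∂μ.restrict U, p x) : ∀ᵐ x ∂μ, p x := by
  set s := {x₀ | ∃ U ∈ 𝓝 x₀, ∀ᵐ x ∂μ.restrict U, p x} with hs
  have hnull : μ ({x | ¬ p x} ∩ s) = 0 := by
    refine measure_null_of_locally_null _ fun x hx => ?_
    obtain ⟨U, hU, hp⟩ := hx.2
    refine ⟨{x | ¬ p x} ∩ s ∩ U, inter_mem_nhdsWithin _ hU, ?_⟩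
    refine measure_mono_null ?_ (le_antisymm
      ((Measure.le_restrict_apply U {x | ¬ p x}).trans (ae_iff.1 hp).le) zero_le)
    exact Set.inter_subset_inter_left _ Set.inter_subset_left
  have hnull' : ∀ᵐ x ∂μ, ¬ (¬ p x ∧ x ∈ s) := by
    rw [ae_iff]
    convert hnull using 2
    ext x
    simp
  filter_upwards [h, hnull'] with x hx hx'
  by_contra hp
  exact hx' ⟨hp, hx⟩

theorem ae_le_of_forall_gt {X : Type*} [MeasurableSpace X] {μ : Measure X} {f : X → ℝ≥0∞} {v : ℝ≥0}
    (h : ∀ v' : ℝ≥0, v < v' → ∀ᵐ x ∂μ, f x ≤ v') : ∀ᵐ x ∂μ, f x ≤ v := by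
  obtain ⟨u, -, hu, hlim⟩ := exists_seq_strictAnti_tendsto v
  filter_upwards [ae_all_iff.2 fun k => h (u k) (hu k)] with x hx
  exact ge_of_tendsto' (ENNReal.tendsto_coe.2 hlim) hx

theorem eventually_le_mul_natCast (a : ℝ) {b : ℝ} (hb : 0 < b) :
    ∀ᶠ t : ℕ in atTop, a ≤ b * t :=
  (tendsto_natCast_atTop_atTop.const_mul_atTop hb).eventually_ge_atTop a

theorem tendsto_natCeil_logb_two :
    Tendsto (fun Q : ℝ => ⌈Real.logb 2 Q⌉₊) atTop atTop :=
  tendsto_nat_ceil_atTop.comp (Real.tendsto_logb_atTop (by norm_num))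

/-- Rounding `Q` up to a power of two costs at most a factor 2 in `Q`; the gap between `w₁` and `w₂`
absorbs it once `(w₂ - w₁) t ≥ w₂`. -/
theorem eventually_rpow_neg_le {w₁ w₂ : ℝ} (h : w₁ < w₂) (hw : 0 ≤ w₂) :
    ∀ᶠ Q : ℝ in atTop, 1 ≤ Q ∧ Q ≤ (2 : ℝ) ^ ⌈Real.logb 2 Q⌉₊ ∧
      Q ^ (-w₂) ≤ (2 : ℝ) ^ (-(w₁ * ⌈Real.logb 2 Q⌉₊)) := by
  have h1 := tendsto_natCeil_logb_two.eventually (eventually_le_mul_natCast w₂ (sub_pos.2 h))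
  filter_upwards [h1, eventually_ge_atTop 1] with Q hQ hQ1
  have hQ0 : 0 < Q := by linarith
  have hlog : 0 ≤ Real.logb 2 Q := Real.logb_nonneg (by norm_num) hQ1
  have hceil := Nat.le_ceil (Real.logb 2 Q)
  have hceil' := Nat.ceil_lt_add_one hlog
  set t := ⌈Real.logb 2 Q⌉₊
  have hQe : Q = (2 : ℝ) ^ Real.logb 2 Q := (Real.rpow_logb (by norm_num) (by norm_num) hQ0).symm
  refine ⟨hQ1, ?_, ?_⟩
  · rw [← Real.rpow_natCast]
    conv_lhs => rw [hQe]
    exact Real.rpow_le_rpow_of_exponent_le (by norm_num) hceil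
  · conv_lhs => rw [hQe, ← Real.rpow_mul (by norm_num)]
    refine Real.rpow_le_rpow_of_exponent_le (by norm_num) ?_
    nlinarith

theorem omega_le_of_eventually {X : Mat m n} {θ : Fin m → ℝ} {w : ℝ≥0} {w₁ : ℝ} (hw : w₁ < w)
    (h : ∀ᶠ t : ℕ in atTop, ∀ q : Fin n → ℤ, q ≠ 0 → ‖q‖ ≤ (2 : ℝ) ^ t →
      (2 : ℝ) ^ (-(w₁ * t)) ≤ ‖centered (affineForm X θ q)‖) :
    omega X θ ≤ w := by
  refine iSup₂_le fun w₂ hfreq => ?_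
  by_contra! hlt
  have hw₂ : w₁ < w₂ := hw.trans (by exact_mod_cast hlt)
  obtain ⟨Q, ⟨q, hq0, hq, hqQ⟩, hQ, hQt⟩ :=
    (hfreq.and_eventually ((eventually_rpow_neg_le hw₂ w₂.2).and
      (tendsto_natCeil_logb_two.eventually h))).exists
  have := hQt q hq0 (hqQ.trans hQ.2.1)
  have := hQ.2.2
  linarith

theorem omegaMul_le_of_eventually (hm : 0 < m) {X : Mat m n} {θ : Fin m → ℝ} {w : ℝ≥0} {w₁ : ℝ}
    (hw : w₁ < w)
    (h : ∀ᶠ t : ℕ in atTop, ∀ q : Fin n → ℤ, q ≠ 0 →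
      ∏ i, max 1 |(q i : ℝ)| ≤ ((2 : ℝ) ^ t) ^ n →
      (2 : ℝ) ^ (-(m * w₁ * t)) ≤ ∏ j, |centered (affineForm X θ q) j|) :
    omegaMul X θ ≤ w := by
  refine iSup₂_le fun w₂ hfreq => ?_
  by_contra! hlt
  have hw₂ : w₁ < w₂ := hw.trans (by exact_mod_cast hlt)
  have hm' : (0 : ℝ) < m := by exact_mod_cast hm
  obtain ⟨Q, ⟨q, hq0, hq, hqQ⟩, hQ, hQt⟩ :=
    (hfreq.and_eventually ((eventually_rpow_neg_le (mul_lt_mul_of_pos_left hw₂ hm')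
      (by positivity)).and (tendsto_natCeil_logb_two.eventually h))).exists
  have := hQt q hq0 (hqQ.trans (pow_le_pow_left₀ (by linarith [hQ.1]) hQ.2.1 n))
  have := hQ.2.2
  linarith

theorem eventually_rpow_neg_le_of_omega_lt {X : Mat m n} {θ : Fin m → ℝ} {w : ℝ≥0}
    (h : omega X θ < w) : ∀ᶠ Q : ℝ in atTop, ∀ q : Fin n → ℤ, q ≠ 0 → ‖q‖ ≤ Q →
      Q ^ (-(w : ℝ)) ≤ ‖centered (affineForm X θ q)‖ := by
  by_contra hcon
  refine h.not_ge (le_iSup₂_of_le w ?_ le_rfl)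
  refine (not_eventually.1 hcon).mono fun Q hQ => ?_
  push Not at hQ
  obtain ⟨q, h1, h2, h3⟩ := hQ
  exact ⟨q, h1, h3, h2⟩

theorem eventually_rpow_neg_le_of_omegaMul_lt {X : Mat m n} {θ : Fin m → ℝ} {w : ℝ≥0}
    (h : omegaMul X θ < w) : ∀ᶠ Q : ℝ in atTop, ∀ q : Fin n → ℤ, q ≠ 0 →
      ∏ i, max 1 |(q i : ℝ)| ≤ Q ^ n →
      Q ^ (-((m : ℝ) * w)) ≤ ∏ j, |centered (affineForm X θ q) j| := by
  by_contra hcon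
  refine h.not_ge (le_iSup₂_of_le w ?_ le_rfl)
  refine (not_eventually.1 hcon).mono fun Q hQ => ?_
  push Not at hQ
  obtain ⟨q, h1, h2, h3⟩ := hQ
  exact ⟨q, h1, h3, h2⟩

end Reductions

/-! ### The simultaneous exponent -/

section Simultaneous

variable {m n : ℕ}

theorem IsContracting.ae_omega_le {ν : Measure (Mat m n)} (hν : IsContracting ν) {v v' : ℝ≥0}
    (hv : v < v') (h : ∀ᵐ X ∂ν, omega X 0 = v) (θ : Fin m → ℝ) :
    ∀ᵐ X ∂ν, omega X θ ≤ v' := by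
  obtain ⟨w, hvw, hwv⟩ := exists_between hv
  obtain ⟨C, α, r₀, -, hα, hr₀, hcon⟩ := hν.contracts
  have hwv' : (w : ℝ) < v' := by exact_mod_cast hwv
  have hw0 : (0 : ℝ) ≤ w := w.2
  -- The outer exponent `e` exceeds `w`, so collisions contradict the homogeneous bound; the inner
  -- one `e + γ` stays below `v'`.
  set e : ℝ := (w + v') / 2 with he
  set γ : ℝ := (v' - w) / 4 with hγ
  have he0 : 0 < e := by linarith
  have hγ0 : 0 < γ := by linarith
  have key := ae_eventually_le_abs_affineForm hν.finite hν.doubling (C := C) hα (fun _ => e)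
    hγ0 ?_ (fun t => {q : Fin n → ℤ | ‖q‖ ≤ (2 : ℝ) ^ t}) θ ?_
  · filter_upwards [key] with X hX
    refine omega_le_of_eventually (w₁ := e + γ) (by linarith) ?_
    filter_upwards [hX] with t ht q hq0 hq
    obtain ⟨j, hj⟩ := ht q hq hq0 (fun j => round (affineForm X θ q j))
      (fun j hj => absurd hj (not_le.2 he0))
    refine hj.trans ?_
    rw [← Real.norm_eq_abs]
    exact norm_le_pi_norm (centered (affineForm X θ q)) j
  · filter_upwards [(tendsto_two_rpow_neg_mul he0).eventually_lt_const hr₀] with t ht s hs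
    exact hcon _ (by positivity) ((div_le_self (by positivity) hs).trans_lt ht)
  · filter_upwards [h] with X hX
    have h1 := eventually_rpow_neg_le_of_omega_lt (X := X) (θ := 0) (w := w)
      (by rw [hX]; exact_mod_cast hvw)
    -- A difference of two vectors of norm at most `2 ^ t` has norm at most `2 ^ (t + 1)`.
    have htend : Tendsto (fun t : ℕ => (2 : ℝ) ^ (t + 1)) atTop atTop :=
      (tendsto_pow_atTop_atTop_of_one_lt (by norm_num)).comp (tendsto_add_atTop_nat 1)
    filter_upwards [htend.eventually h1, eventually_le_mul_natCast (1 + w) (sub_pos.2 hwv' |> half_pos)]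
      with t ht ht2 q hq q' hq' hne
    by_contra! hcon
    have hq : ‖q‖ ≤ (2 : ℝ) ^ t := hq
    have hq' : ‖q'‖ ≤ (2 : ℝ) ^ t := hq'
    have h2 := ht (q - q') (sub_ne_zero.2 hne) ((norm_sub_le _ _).trans (by rw [pow_succ]; linarith))
    refine h2.not_gt ?_
    have h3 : 2 * (2 : ℝ) ^ (-(e * t)) ≤ ((2 : ℝ) ^ (t + 1)) ^ (-(w : ℝ)) := by
      rw [← Real.rpow_natCast, ← Real.rpow_mul (by norm_num)]
      nth_rw 1 [← Real.rpow_one 2]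
      rw [← Real.rpow_add (by norm_num)]
      refine Real.rpow_le_rpow_of_exponent_le (by norm_num) ?_
      push_cast
      rw [he]
      linarith
    refine lt_of_lt_of_le ?_ h3
    exact (pi_norm_lt_iff (by positivity)).2 fun j => by
      rw [Real.norm_eq_abs]; exact hcon j he0

end Simultaneous

/-! ### The multiplicative exponent -/

section Multiplicative

variable {m n : ℕ}

/-- Dyadic-type approximation of a small product from above, with capped exponents. -/
theorem exists_pow_grid_of_le_one {B : ℝ} (hB0 : 0 < B) {y : Fin m → ℝ}
    (hy1 : ∀ j, y j ≤ 1) (L : ℕ) :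
    ∃ k : Fin m → ℕ, (∀ j, k j ≤ L) ∧ (∀ j, y j ≤ B ^ k j) ∧
      (B ^ (∑ j, k j + m) ≤ ∏ j, y j ∨ L ≤ ∑ j, k j) := by
  classical
  set k : Fin m → ℕ := fun j => Nat.findGreatest (fun i => y j ≤ B ^ i) L with hk
  refine ⟨k, fun j => Nat.findGreatest_le L, fun j => ?_, ?_⟩
  · exact Nat.findGreatest_spec (P := fun i => y j ≤ B ^ i) (Nat.zero_le L) (by simpa using hy1 j)
  · by_cases hL : ∃ j, L ≤ k j
    · obtain ⟨j, hj⟩ := hL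
      exact Or.inr (hj.trans (Finset.single_le_sum (f := k) (fun _ _ => Nat.zero_le _)
        (Finset.mem_univ j)))
    · push Not at hL
      left
      have h1 : B ^ (∑ j, k j + m) = ∏ j, B ^ (k j + 1) := by
        rw [Finset.prod_pow_eq_pow_sum, Finset.sum_add_distrib]
        simp
      rw [h1]
      refine Finset.prod_le_prod (fun j _ => by positivity) fun j _ => ?_
      have h2 := Nat.findGreatest_is_greatest (P := fun i => y j ≤ B ^ i) (n := L) (k := k j + 1)
        (Nat.lt_succ_self _) (hL j)
      exact (not_le.1 h2).le

theorem exists_pow_grid_of_one_le {D : ℝ} (hD : 1 < D) {x : Fin n → ℝ} (hx : ∀ i, 1 ≤ x i) :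
    ∃ l : Fin n → ℕ, (∀ i, x i ≤ D ^ l i) ∧ D ^ (∑ i, l i) ≤ D ^ n * ∏ i, x i := by
  choose k hk1 hk2 using fun i => exists_nat_pow_near (hx i) hD
  refine ⟨fun i => k i + 1, fun i => (hk2 i).le, ?_⟩
  rw [← Finset.prod_pow_eq_pow_sum]
  calc ∏ i, D ^ (k i + 1) = ∏ i, D * D ^ k i := by simp only [pow_succ']
    _ = D ^ n * ∏ i, D ^ k i := by rw [Finset.prod_mul_distrib]; simp
    _ ≤ _ := by
      gcongr with i
      exact hk1 i

theorem abs_centered_le_half (y : Fin m → ℝ) (j : Fin m) : |centered y j| ≤ 1 / 2 :=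
  abs_sub_round (y j)

/-- The exponents of the box attached to `k`: coordinates with `k j = 0` get the exponent `-Λ`. -/
noncomputable def boxExponent (η Λ : ℝ) (k : Fin m → ℕ) (j : Fin m) : ℝ :=
  if k j = 0 then -Λ else η * k j - η / 2

theorem boxExponent_pos {η Λ : ℝ} (hη : 0 < η) {k : Fin m → ℕ} {j : Fin m} (hj : k j ≠ 0) :
    0 < boxExponent η Λ k j := by
  rw [boxExponent, if_neg hj]
  have : (1 : ℝ) ≤ k j := by exact_mod_cast Nat.one_le_iff_ne_zero.2 hj
  nlinarith

theorem eq_zero_of_boxExponent_nonpos {η Λ : ℝ} (hη : 0 < η) {k : Fin m → ℕ} {j : Fin m}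
    (hj : boxExponent η Λ k j ≤ 0) : k j = 0 := by
  by_contra h
  exact hj.not_gt (boxExponent_pos hη h)

/-- The measure estimate for one shape of box. -/
theorem IsStronglyContracting.ae_eventually_box {ν : Measure (Mat m n)}
    (hν : IsStronglyContracting ν) {w w' η Λ : ℝ} (hη : 0 < η)
    (hw0 : 0 ≤ w) (hm : 0 < m) (hww' : η * (w + 3) < w' - w)
    (h : ∀ᵐ X ∂ν, ∀ᶠ Q : ℝ in atTop, ∀ q : Fin n → ℤ, q ≠ 0 →
      ∏ i, max 1 |(q i : ℝ)| ≤ Q ^ n →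
      Q ^ (-((m : ℝ) * w)) ≤ ∏ j, |centered (affineForm X 0 q) j|)
    (k : Fin m → ℕ) (l : Fin n → ℕ) (hk : m * (w' - 2 * η) ≤ η * ∑ j, (k j : ℝ))
    (hl : η * ∑ i, (l i : ℝ) ≤ n * (1 + η)) (θ : Fin m → ℝ) :
    ∀ᵐ X ∂ν, ∀ᶠ t : ℕ in atTop, ∀ q : Fin n → ℤ,
      (∀ i, max 1 |(q i : ℝ)| ≤ (2 : ℝ) ^ (η * l i * t)) → q ≠ 0 →
        ∀ p : Fin m → ℤ, (∀ j, k j = 0 → p j = 0) →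
          ∃ j, (2 : ℝ) ^ (-((boxExponent η Λ k j + η / 4) * t)) ≤ |affineForm X θ q j - p j| := by
  obtain ⟨C, α, r₀, -, hα, hr₀, hcon⟩ := hν.contracts
  have hm' : (0 : ℝ) < m := by exact_mod_cast hm
  -- Some side must tend to zero for strong contraction to apply.
  have hkpos : ∃ j, k j ≠ 0 := by
    by_contra! h0
    have h1 : ∑ j, (k j : ℝ) = 0 := by simp [h0]
    rw [h1, mul_zero] at hk
    have : 0 < w' - 2 * η := by nlinarith
    have := mul_pos hm' this
    linarith
  obtain ⟨j₀, hj₀⟩ := hkpos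
  have hej₀ := boxExponent_pos (Λ := Λ) hη hj₀
  have hη4 : 0 < η / 4 := by linarith
  have key := ae_eventually_le_abs_affineForm hν.finite hν.doubling (C := C) hα
    (boxExponent η Λ k) hη4 ?_
    (fun t => {q : Fin n → ℤ | ∀ i, max 1 |(q i : ℝ)| ≤ (2 : ℝ) ^ (η * l i * t)}) θ ?_
  · filter_upwards [key] with X hX
    filter_upwards [hX] with t ht q hq hq0 p hp
    exact ht q hq hq0 p fun j hj => hp j (eq_zero_of_boxExponent_nonpos hη hj)
  · filter_upwards [(tendsto_two_rpow_neg_mul hej₀).eventually_lt_const hr₀] with t ht s hs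
    exact hcon _ (fun j => by positivity) ⟨j₀, (div_le_self (by positivity) hs).trans_lt ht⟩
  · filter_upwards [h] with X hX
    -- Height for `q - q'`: the 1 pays for the subtraction, the `η` for rounding `q` to the grid.
    have htend : Tendsto (fun t : ℕ => (2 : ℝ) ^ (1 + (1 + η) * (t : ℝ))) atTop atTop :=
      (tendsto_rpow_atTop_of_base_gt_one (b := (2 : ℝ)) (by norm_num)).comp
        (tendsto_atTop_add_const_left _ _ (tendsto_natCast_atTop_atTop.const_mul_atTop
          (by linarith)))
    -- Exponent gap per coordinate: `2 η` is lost in the sum of the `k j` and `η / 2` in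
    -- `boxExponent`.
    have hβ : 0 < w' - 5 * η / 2 - w * (1 + η) := by nlinarith
    filter_upwards [htend.eventually hX, eventually_le_mul_natCast (2 + w) hβ]
      with t ht ht2 q hq q' hq' hne
    have hq : ∀ i, max 1 |(q i : ℝ)| ≤ (2 : ℝ) ^ (η * l i * t) := hq
    have hq' : ∀ i, max 1 |(q' i : ℝ)| ≤ (2 : ℝ) ^ (η * l i * t) := hq'
    by_contra! hlt
    have ht0 : (0 : ℝ) ≤ t := t.cast_nonneg
    have hprod : ∏ i, max 1 |((q - q') i : ℝ)| ≤ ((2 : ℝ) ^ (1 + (1 + η) * (t : ℝ))) ^ n := by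
      calc ∏ i, max 1 |(((q - q') i : ℤ) : ℝ)| ≤ ∏ i, (2 : ℝ) ^ (1 + η * l i * t) := by
            refine Finset.prod_le_prod (fun i _ => by positivity) fun i _ => ?_
            have h1 := max_le_iff.1 (hq i)
            have h2 := max_le_iff.1 (hq' i)
            have h3 := abs_sub (q i : ℝ) (q' i)
            rw [Real.rpow_add (by norm_num), Real.rpow_one, Pi.sub_apply]
            push_cast
            exact max_le (by linarith) (by linarith)
        _ = (2 : ℝ) ^ (∑ i, (1 + η * l i * t)) := (Real.rpow_sum_of_pos (by norm_num) _ _).symm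
        _ ≤ (2 : ℝ) ^ ((1 + (1 + η) * (t : ℝ)) * n) := by
            refine Real.rpow_le_rpow_of_exponent_le (by norm_num) ?_
            rw [Finset.sum_add_distrib, ← Finset.sum_mul, ← Finset.mul_sum]
            simp only [Finset.sum_const, Finset.card_univ, Fintype.card_fin, nsmul_eq_mul, mul_one]
            nlinarith [mul_le_mul_of_nonneg_right hl ht0]
        _ = _ := by rw [← Real.rpow_natCast ((2 : ℝ) ^ _), ← Real.rpow_mul (by norm_num)]
    refine (ht (q - q') (sub_ne_zero.2 hne) hprod).not_gt ?_
    calc ∏ j, |centered (affineForm X 0 (q - q')) j|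
        ≤ ∏ j, (2 : ℝ) ^ (1 - (η * k j - η / 2) * t) := by
          refine Finset.prod_le_prod (fun j _ => abs_nonneg _) fun j _ => ?_
          by_cases hj : k j = 0
          · refine (abs_centered_le_half _ j).trans ?_
            have : (1 : ℝ) ≤ (2 : ℝ) ^ (1 - (η * k j - η / 2) * t) := by
              refine Real.one_le_rpow (by norm_num) ?_
              rw [hj]
              push_cast
              have := mul_nonneg hη.le ht0
              linarith
            linarith
          · have h1 := hlt j (boxExponent_pos hη hj)
            rw [boxExponent, if_neg hj] at h1
            rw [sub_eq_add_neg (1 : ℝ), Real.rpow_add (by norm_num), Real.rpow_one]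
            exact h1.le
      _ = (2 : ℝ) ^ (∑ j, (1 - (η * k j - η / 2) * t)) :=
          (Real.rpow_sum_of_pos (by norm_num) _ _).symm
      _ < (2 : ℝ) ^ ((1 + (1 + η) * (t : ℝ)) * (-((m : ℝ) * w))) := by
          refine Real.rpow_lt_rpow_of_exponent_lt (by norm_num) ?_
          rw [Finset.sum_sub_distrib, ← Finset.sum_mul, Finset.sum_sub_distrib, ← Finset.mul_sum]
          simp only [Finset.sum_const, Finset.card_univ, Fintype.card_fin, nsmul_eq_mul, mul_one]
          have h1 := mul_le_mul_of_nonneg_right hk ht0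
          have h2 := mul_le_mul_of_nonneg_left ht2 hm'.le
          nlinarith
      _ = _ := by rw [← Real.rpow_mul (by norm_num)]

/-- The multiplicative exponent of a strongly contracting measure: every solution of the product
inequality lies in one of finitely many shapes of boxes. -/
theorem IsStronglyContracting.ae_omegaMul_le {ν : Measure (Mat m n)}
    (hν : IsStronglyContracting ν) (hm : 0 < m) {v v' : ℝ≥0}
    (hv : v < v') (h : ∀ᵐ X ∂ν, omegaMul X 0 = v) (θ : Fin m → ℝ) :
    ∀ᵐ X ∂ν, omegaMul X θ ≤ v' := by
  obtain ⟨w, hvw, hwv⟩ := exists_between hv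
  have hwv' : (w : ℝ) < v' := by exact_mod_cast hwv
  have hw0 : (0 : ℝ) ≤ w := w.2
  have hm' : (0 : ℝ) < m := by exact_mod_cast hm
  set η : ℝ := (v' - w) / (2 * (w + 3)) with hη
  have hη0 : 0 < η := div_pos (by linarith) (by positivity)
  have hηw : η * (w + 3) < v' - w := by
    have : η * (w + 3) = (v' - w) / 2 := by rw [hη]; field_simp
    linarith
  -- The `η / 4` cancels the inner shrinking, leaving side `2 ^ ((n + 1) t)`, which eventually
  -- exceeds every `|affineForm X θ q j|` in range.
  set Λ : ℝ := n + 1 + η / 4 with hΛ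
  -- With these caps only finitely many shapes `(k, l)` occur, so the almost-everywhere and eventual
  -- statements hold for all of them at once.
  obtain ⟨L, hL⟩ := exists_nat_ge (m * v' / η : ℝ)
  obtain ⟨L', hL'⟩ := exists_nat_ge (n * (1 + η) / η : ℝ)
  have hLη : m * v' ≤ η * L := by rw [div_le_iff₀ hη0] at hL; linarith
  have hbase : ∀ᵐ X ∂ν, ∀ᶠ Q : ℝ in atTop, ∀ q : Fin n → ℤ, q ≠ 0 →
      ∏ i, max 1 |(q i : ℝ)| ≤ Q ^ n →
      Q ^ (-((m : ℝ) * w)) ≤ ∏ j, |centered (affineForm X 0 q) j| := by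
    filter_upwards [h] with X hX
    exact eventually_rpow_neg_le_of_omegaMul_lt (by rw [hX]; exact_mod_cast hvw)
  have hall : ∀ᵐ X ∂ν, ∀ (k : Fin m → Fin (L + 1)) (l : Fin n → Fin (L' + 1)),
      m * (v' - 2 * η) ≤ η * ∑ j, ((k j : ℕ) : ℝ) →
      η * ∑ i, ((l i : ℕ) : ℝ) ≤ n * (1 + η) → ∀ᶠ t : ℕ in atTop, ∀ q : Fin n → ℤ,
      (∀ i, max 1 |(q i : ℝ)| ≤ (2 : ℝ) ^ (η * (l i : ℕ) * t)) → q ≠ 0 →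
        ∀ p : Fin m → ℤ, (∀ j, (k j : ℕ) = 0 → p j = 0) →
          ∃ j, (2 : ℝ) ^ (-((boxExponent η Λ (fun j => (k j : ℕ)) j + η / 4) * t)) ≤
            |affineForm X θ q j - p j| := by
    refine ae_all_iff.2 fun k => ae_all_iff.2 fun l => ?_
    by_cases hk : m * (v' - 2 * η) ≤ η * ∑ j, ((k j : ℕ) : ℝ)
    · by_cases hl : η * ∑ i, ((l i : ℕ) : ℝ) ≤ n * (1 + η)
      · filter_upwards [hν.ae_eventually_box (Λ := Λ) hη0 hw0 hm hηw hbase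
          (fun j => (k j : ℕ)) (fun i => (l i : ℕ)) hk hl θ] with X hX _ _ using hX
      · exact Eventually.of_forall fun X _ h' => absurd h' hl
    · exact Eventually.of_forall fun X h' => absurd h' hk
  filter_upwards [hall] with X hX
  refine omegaMul_le_of_eventually (w₁ := v' - η) hm (by linarith) ?_
  have hX' : ∀ᶠ t : ℕ in atTop, ∀ (k : Fin m → Fin (L + 1)) (l : Fin n → Fin (L' + 1)),
      m * (v' - 2 * η) ≤ η * ∑ j, ((k j : ℕ) : ℝ) →
      η * ∑ i, ((l i : ℕ) : ℝ) ≤ n * (1 + η) → ∀ q : Fin n → ℤ,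
      (∀ i, max 1 |(q i : ℝ)| ≤ (2 : ℝ) ^ (η * (l i : ℕ) * t)) → q ≠ 0 →
        ∀ p : Fin m → ℤ, (∀ j, (k j : ℕ) = 0 → p j = 0) →
          ∃ j, (2 : ℝ) ^ (-((boxExponent η Λ (fun j => (k j : ℕ)) j + η / 4) * t)) ≤
            |affineForm X θ q j - p j| := by
    refine eventually_all.2 fun k => eventually_all.2 fun l => ?_
    by_cases hk : m * (v' - 2 * η) ≤ η * ∑ j, ((k j : ℕ) : ℝ)
    · by_cases hl : η * ∑ i, ((l i : ℕ) : ℝ) ≤ n * (1 + η)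
      · filter_upwards [hX k l hk hl] with t ht _ _ using ht
      · exact Eventually.of_forall fun X _ h' => absurd h' hl
    · exact Eventually.of_forall fun X h' => absurd h' hk
  set A : ℝ := ∑ j, (∑ i, |X j i| + |θ j|) with hA
  have hlarge : ∀ᶠ t : ℕ in atTop, A < (2 : ℝ) ^ t :=
    (tendsto_pow_atTop_atTop_of_one_lt (by norm_num)).eventually_gt_atTop A
  filter_upwards [hX', hlarge, eventually_ge_atTop 1] with t ht htA ht1 q hq0 hq
  by_contra! hlt
  have ht0 : (0 : ℝ) < t := by exact_mod_cast ht1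
  have hηt : 0 < η * t := by positivity
  obtain ⟨k, hkL, hky, hkprod⟩ := exists_pow_grid_of_le_one (B := (2 : ℝ) ^ (-(η * t)))
    (by positivity) (y := fun j => |centered (affineForm X θ q) j|)
    (fun j => (abs_centered_le_half _ j).trans (by norm_num)) L
  obtain ⟨l, hlx, hlprod⟩ := exists_pow_grid_of_one_le (D := (2 : ℝ) ^ (η * t))
    (Real.one_lt_rpow (by norm_num) hηt) (x := fun i => max 1 |(q i : ℝ)|)
    (fun i => le_max_left _ _)
  -- One `η` comes from the target exponent `v' - η`, the other from rounding each of the `m`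
  -- factors to the grid.
  have hk : m * (v' - 2 * η) ≤ η * ∑ j, (k j : ℝ) := by
    rcases hkprod with h1 | h1
    · have h2 := h1.trans_lt hlt
      rw [← Real.rpow_natCast, ← Real.rpow_mul (by norm_num),
        Real.rpow_lt_rpow_left_iff (by norm_num)] at h2
      push_cast at h2
      have h3 : (m * (v' - η)) * t < (η * ∑ j, (k j : ℝ) + η * m) * t := by linarith
      have h4 := lt_of_mul_lt_mul_right h3 ht0.le
      linarith
    · have h2 : (L : ℝ) ≤ ∑ j, (k j : ℝ) := by exact_mod_cast h1
      have h3 := mul_le_mul_of_nonneg_left h2 hη0.le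
      have h4 := mul_pos hm' hη0
      linarith
  have hl : η * ∑ i, (l i : ℝ) ≤ n * (1 + η) := by
    have h1 : ((2 : ℝ) ^ (η * t)) ^ (∑ i, l i) ≤ ((2 : ℝ) ^ (η * t)) ^ n * ((2 : ℝ) ^ t) ^ n :=
      hlprod.trans (by gcongr)
    rw [← mul_pow, ← Real.rpow_natCast 2 t, ← Real.rpow_add (by norm_num), ← Real.rpow_natCast,
      ← Real.rpow_natCast, ← Real.rpow_mul (by norm_num), ← Real.rpow_mul (by norm_num),
      Real.rpow_le_rpow_left_iff (by norm_num)] at h1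
    push_cast at h1
    have h3 : (η * ∑ i, (l i : ℝ)) * t ≤ (n * (1 + η)) * t := by linarith
    exact le_of_mul_le_mul_right h3 ht0
  have hlL : ∀ i, l i ≤ L' := by
    intro i
    have h1 : (l i : ℝ) ≤ ∑ i, (l i : ℝ) :=
      Finset.single_le_sum (f := fun i => (l i : ℝ)) (fun _ _ => by positivity) (Finset.mem_univ i)
    have h2 : ∑ i, (l i : ℝ) ≤ n * (1 + η) / η := by rw [le_div_iff₀ hη0]; linarith
    exact_mod_cast (h1.trans h2).trans hL'
  obtain ⟨j, hj⟩ := ht (fun j => ⟨k j, Nat.lt_succ_of_le (hkL j)⟩)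
    (fun i => ⟨l i, Nat.lt_succ_of_le (hlL i)⟩) hk hl q (fun i => by
      refine (hlx i).trans_eq ?_
      rw [← Real.rpow_natCast, ← Real.rpow_mul (by norm_num)]
      congr 1
      ring) hq0
    (fun j => if k j = 0 then 0 else round (affineForm X θ q j)) (fun j hj => if_pos hj)
  refine hj.not_gt ?_
  by_cases hkj : k j = 0
  · rw [if_pos hkj, boxExponent, if_pos hkj, Int.cast_zero, sub_zero]
    have hqi : ∀ i, |(q i : ℝ)| ≤ ((2 : ℝ) ^ t) ^ n := fun i => by
      refine (le_max_right 1 _).trans (le_trans ?_ hq)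
      rw [← Finset.mul_prod_erase Finset.univ _ (Finset.mem_univ i)]
      exact le_mul_of_one_le_right (by positivity) (Finset.prod_induction _ (fun x : ℝ => 1 ≤ x)
        (fun _ _ => one_le_mul_of_one_le_of_one_le) le_rfl fun _ _ => le_max_left _ _)
    have hone : (1 : ℝ) ≤ ((2 : ℝ) ^ t) ^ n := one_le_pow₀ (one_le_pow₀ (by norm_num))
    calc |affineForm X θ q j| ≤ ∑ i, |X j i * q i| + |θ j| :=
          (abs_add_le _ _).trans (by gcongr; exact Finset.abs_sum_le_sum_abs _ _)
      _ ≤ ∑ i, |X j i| * ((2 : ℝ) ^ t) ^ n + |θ j| * ((2 : ℝ) ^ t) ^ n := by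
          gcongr with i
          · rw [abs_mul]
            gcongr
            exact hqi i
          · exact le_mul_of_one_le_right (abs_nonneg _) hone
      _ = (∑ i, |X j i| + |θ j|) * ((2 : ℝ) ^ t) ^ n := by rw [add_mul, Finset.sum_mul]
      _ ≤ A * ((2 : ℝ) ^ t) ^ n := by
          gcongr
          exact Finset.single_le_sum (f := fun j => ∑ i, |X j i| + |θ j|)
            (fun j _ => by positivity) (Finset.mem_univ j)
      _ < (2 : ℝ) ^ t * ((2 : ℝ) ^ t) ^ n := by gcongr
      _ = (2 : ℝ) ^ (-((-Λ + η / 4) * t)) := by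
          rw [← pow_succ', ← pow_mul, ← Real.rpow_natCast, hΛ]
          congr 1
          push_cast
          ring
  · rw [if_neg hkj, boxExponent, if_neg hkj]
    -- The inner exponent is `η k j - η / 4`, so the grid bound `2 ^ (-(η k j t))` lies strictly
    -- inside the box.
    refine (hky j).trans_lt ?_
    rw [← Real.rpow_natCast, ← Real.rpow_mul (by norm_num)]
    refine Real.rpow_lt_rpow_of_exponent_lt (by norm_num) ?_
    nlinarith

end Multiplicative
end DiophTransfer

theorem mainTheorem1 (m n : ℕ) (hm : 0 < m) (hn : 0 < n)
    (μ : MeasureTheory.Measure (DiophTransfer.Mat m n)) :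
    (DiophTransfer.ContractingAE μ →
      ∀ v : ℝ≥0∞, (∀ᵐ X ∂μ, DiophTransfer.omega X 0 = v) →
        ∀ θ : Fin m → ℝ, ∀ᵐ X ∂μ, DiophTransfer.omega X θ ≤ v) ∧
    (DiophTransfer.StronglyContractingAE μ →
      ∀ v : ℝ≥0∞, (∀ᵐ X ∂μ, DiophTransfer.omegaMul X 0 = v) →
        ∀ θ : Fin m → ℝ, ∀ᵐ X ∂μ, DiophTransfer.omegaMul X θ ≤ v) := by
  refine ⟨fun hμ v hv θ => ?_, fun hμ v hv θ => ?_⟩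
  · rcases eq_or_ne v ∞ with rfl | hvtop
    · exact Eventually.of_forall fun X => le_top
    lift v to ℝ≥0 using hvtop
    refine DiophTransfer.ae_le_of_forall_gt fun v' hv' => DiophTransfer.ae_of_ae_restrict_nhds ?_
    filter_upwards [hμ] with X₀ ⟨U, hU, hUc⟩
    exact ⟨U, hU, hUc.ae_omega_le hv' (ae_restrict_of_ae hv) θ⟩
  · rcases eq_or_ne v ∞ with rfl | hvtop
    · exact Eventually.of_forall fun X => le_top
    lift v to ℝ≥0 using hvtop
    refine DiophTransfer.ae_le_of_forall_gt fun v' hv' => DiophTransfer.ae_of_ae_restrict_nhds ?_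
    filter_upwards [hμ] with X₀ ⟨U, hU, hUc⟩
    exact ⟨U, hU, hUc.ae_omegaMul_le hm hv' (ae_restrict_of_ae hv) θ⟩
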